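/- Let \(\alpha>0\). For \(g\in L^1[-\pi,\pi]\) let \(u_g\) denote the solution of the Robin problem with heat source \(g\): the unique \(C^1\) function \(u\) on \([-\pi,\pi]\) such that \(u'\) is absolutely continuous on \([-\pi,\pi]\), \(-u''=g\) almost everywhere on \((-\pi,\pi)\), and \[-u'(-\pi)+\alpha u(-\pi)=u'(\pi)+\alpha u(\pi)=0.\] Let \(0\le f\in L^1[-\pi,\pi]\), and let \(f^\#\) be its symmetric decreasing rearrangement, that is, \(f^\#(x)=f^*(2|x|)\) for \(x\in[-\pi,\pi]\), where, with \(\lambda\) denoting Lebesgue measure, \[f^*(t)=\inf\bigl\{s\in\mathbb{R}:\lambda(\{x\in[-\pi,\pi]:f(x)>s\})\le t\bigr\}\quad(0<t<2\pi),\] \(f^*(0)=\operatorname{ess\,sup}f\) and \(f^*(2\pi)=\operatorname{ess\,inf}f\). Then \[\|u_f\|_{L^\infty[-\pi,\pi]}\le\|u_{f^\#}\|_{L^\infty[-\pi,\pi]}=u_{f^\#}(0),\] and \(\|u_f\|_{L^\infty[-\pi,\pi]}=\|u_{f^\#}\|_{L^\infty[-\pi,\pi]}\) if and only if \(f=f^\#\)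 almost everywhere on \([-\pi,\pi]\). -/

import Mathlib

open MeasureTheory Set

/-- The decreasing rearrangement `f^* : [0, λ(X)] → [-∞, ∞]` of a function `f` on `X ⊆ ℝ`
(only arguments `0 ≤ t ≤ λ(X)` are meaningful): the essential supremum of `f` at `t = 0`, the
essential infimum at `t = λ(X)`, and `inf {s ∈ ℝ : λ({x ∈ X : f(x) > s}) ≤ t}` in between. -/
noncomputable def decreasingRearrangement (X : Set ℝ) (f : ℝ → ℝ) (t : ℝ) : EReal :=
  open Classical in
  if t = 0 then essSup (fun x => (f x : EReal)) (volume.restrict X)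
  else if ENNReal.ofReal t = volume X then essInf (fun x => (f x : EReal)) (volume.restrict X)
  else sInf ((fun s : ℝ => (s : EReal)) ''
    {s : ℝ | volume {x | x ∈ X ∧ s < f x} ≤ ENNReal.ofReal t})

/-- The symmetric decreasing rearrangement `f^#(t) = f^*(2|t|)`, for `|t| ≤ λ(X) / 2`. -/
noncomputable def symmDecreasingRearrangement (X : Set ℝ) (f : ℝ → ℝ) (t : ℝ) : EReal :=
  decreasingRearrangement X f (2 * |t|)

/-- `u` is a solution on `[-π, π]` of the Robin problem `-u'' = f`,
`-u'(-π) + α u(-π) = u'(π) + α u(π) = 0`: it is `C¹` on `[-π, π]` (with one-sided derivatives at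
the end-points), `u'` is absolutely continuous on `[-π, π]`, and `-u'' = f` almost everywhere. -/
structure IsRobinSolution (α : ℝ) (f u : ℝ → ℝ) : Prop where
  contDiffOn : ContDiffOn ℝ 1 u (Icc (-Real.pi) Real.pi)
  absolutelyContinuous :
    AbsolutelyContinuousOnInterval (derivWithin u (Icc (-Real.pi) Real.pi)) (-Real.pi) Real.pi
  equation : ∀ᵐ x ∂(volume.restrict (Ioo (-Real.pi) Real.pi)),
    HasDerivAt (derivWithin u (Icc (-Real.pi) Real.pi)) (-f x) x
  left_condition :
    -derivWithin u (Icc (-Real.pi) Real.pi) (-Real.pi) + α * u (-Real.pi) = 0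
  right_condition :
    derivWithin u (Icc (-Real.pi) Real.pi) Real.pi + α * u Real.pi = 0

/-- The `L^∞` norm on `[-π, π]`. -/
noncomputable def supNorm (u : ℝ → ℝ) : ENNReal :=
  eLpNorm u ⊤ (volume.restrict (Icc (-Real.pi) Real.pi))

/-! The solution is `u x = ∫ G(x, y) f(y) dy` with the non-negative kernel `robinGreen`
(`IsRobinSolution.eq_integral_robinGreen`). By the layer cake formula `u x` is the integral over `s
> 0` of `∫ G(x, ·)` over `{f > s}` (`ofReal_integral_robinGreen_mul`), so it is enough to bound `∫
G(x, ·)` over a set of measure `m`.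

As a function of `y`, the kernel is a tent with peak at `x`, so its superlevel sets in `ℝ` are
intervals. The bathtub principle bounds the integral by that over the superlevel interval of length
`m`, which is `m / (4a) - m² / 8` minus a deficit that vanishes only for `m = 0` or `x = 0`
(`setIntegral_robinGreen_le`). Up to null sets the superlevel sets of `f^#` are centred intervals
with the measures of those of `f`, so at `x = 0` every layer of `f^#` attains the bound.

If the norms agree, almost every layer of `f` attains the bound at a maximum point of `u`. Such a
layer is a centred interval (`ae_eq_Ioo_of_setIntegral_robinGreen_eq`), that is, the layer of `f^#`,
whence `f = f^#` almost everywhere. -/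

/-! ### The Green's function -/

/-- The Green's function of the Robin problem on `[-π, π]`, parametrised by
`a = α / (2 * (1 + α * π))`. -/
noncomputable def robinGreen (a x y : ℝ) : ℝ := 1 / (4 * a) - a * x * y - |x - y| / 2

lemma robinGreen_of_le {a x y : ℝ} (h : y ≤ x) :
    robinGreen a x y = (1 / (4 * a) - x / 2) + (1 / 2 - a * x) * y := by
  rw [robinGreen, abs_of_nonneg (by linarith)]; ring

lemma robinGreen_of_ge {a x y : ℝ} (h : x ≤ y) :
    robinGreen a x y = (1 / (4 * a) + x / 2) + (-1 / 2 - a * x) * y := by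
  rw [robinGreen, abs_of_nonpos (by linarith)]; ring

lemma continuous_robinGreen (a x : ℝ) : Continuous (robinGreen a x) := by
  unfold robinGreen; fun_prop

/-- On each side of the diagonal the kernel is a product of two affine functions that are
non-negative on `[-π, π]`, since `2aπ < 1`. -/
lemma robinGreen_nonneg {a x y : ℝ} (ha : 0 < a) (ha' : 2 * a * Real.pi < 1)
    (hx : x ∈ Icc (-Real.pi) Real.pi) (hy : y ∈ Icc (-Real.pi) Real.pi) :
    0 ≤ robinGreen a x y := by
  have bd : ∀ z ∈ Icc (-Real.pi) Real.pi, 0 ≤ 1 - 2 * a * z ∧ 0 ≤ 1 + 2 * a * z := fun z hz =>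
    ⟨by nlinarith [hz.2], by nlinarith [hz.1]⟩
  rcases le_total y x with h | h
  · have : robinGreen a x y = (1 - 2 * a * x) * (1 + 2 * a * y) / (4 * a) := by
      rw [robinGreen_of_le h]; field_simp; ring
    rw [this]
    exact div_nonneg (mul_nonneg (bd x hx).1 (bd y hy).2) (by positivity)
  · have : robinGreen a x y = (1 + 2 * a * x) * (1 - 2 * a * y) / (4 * a) := by
      rw [robinGreen_of_ge h]; field_simp; ring
    rw [this]
    exact div_nonneg (mul_nonneg (bd x hx).2 (bd y hy).1) (by positivity)

lemma integral_affine_mul_deriv {w u : ℝ → ℝ} {p q A B : ℝ} (hpq : p ≤ q)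
    (hw : AbsolutelyContinuousOnInterval w p q) (hu : ContinuousOn u (Icc p q))
    (huw : ∀ x ∈ Ioo p q, HasDerivAt u (w x) x) :
    ∫ y in p..q, (A + B * y) * deriv w y =
      (A + B * q) * w q - (A + B * p) * w p - B * (u q - u p) := by
  have hlip : AbsolutelyContinuousOnInterval (fun y : ℝ => A + B * y) p q := by
    have : LipschitzWith ‖B‖₊ (fun y : ℝ => A + B * y) :=
      LipschitzWith.of_dist_le_mul fun x y => by
        rw [Real.dist_eq, Real.dist_eq, coe_nnnorm, Real.norm_eq_abs, ← abs_mul]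
        apply le_of_eq; congr 1; ring
    exact this.lipschitzOnWith.absolutelyContinuousOnInterval
  rw [hlip.integral_mul_deriv_eq_deriv_mul hw]
  congr 1
  have hd : ∀ y : ℝ, deriv (fun y : ℝ => A + B * y) y = B := fun y => by
    simp
  simp_rw [hd]
  rw [intervalIntegral.integral_const_mul]
  congr 1
  have hwi : IntervalIntegrable w volume p q := hw.continuousOn.intervalIntegrable
  exact intervalIntegral.integral_eq_sub_of_hasDerivAt_of_le hpq hu huw hwi

/-! ### Representation of solutions by the Green's function -/

section Representation

variable {α : ℝ} {f u : ℝ → ℝ}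

lemma IsRobinSolution.ae_deriv_eq (h : IsRobinSolution α f u) :
    ∀ᵐ x ∂(volume.restrict (Icc (-Real.pi) Real.pi)),
      deriv (derivWithin u (Icc (-Real.pi) Real.pi)) x = -f x := by
  rw [restrict_Ioo_eq_restrict_Icc.symm]
  exact h.equation.mono fun x hx => hx.deriv

lemma IsRobinSolution.integrableOn (h : IsRobinSolution α f u) :
    IntegrableOn f (Icc (-Real.pi) Real.pi) := by
  have hpi := Real.pi_pos
  have h1 := h.absolutelyContinuous.intervalIntegrable_deriv.neg
  rw [intervalIntegrable_iff_integrableOn_Icc_of_le (by linarith)] at h1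
  refine Integrable.congr h1 ?_
  filter_upwards [h.ae_deriv_eq] with x hx
  simp [hx]

/-- The kernel is affine in `y` on either side of `x`, so integration by parts on each piece leaves
only boundary terms. The slope drops by `1` at `y = x`, which produces `u x`. -/
lemma IsRobinSolution.eq_integral_robinGreen (h : IsRobinSolution α f u) {a : ℝ} (ha : 0 < a)
    (haα : α * (1 - 2 * a * Real.pi) = 2 * a) {x : ℝ} (hx : x ∈ Icc (-Real.pi) Real.pi) :
    u x = ∫ y in Icc (-Real.pi) Real.pi, robinGreen a x y * f y := by
  have hpi := Real.pi_pos
  set w := derivWithin u (Icc (-Real.pi) Real.pi) with hw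
  have huc : ContinuousOn u (Icc (-Real.pi) Real.pi) := h.contDiffOn.continuousOn
  have huw : ∀ y ∈ Ioo (-Real.pi) Real.pi, HasDerivAt u (w y) y := fun y hy =>
    ((h.contDiffOn.differentiableOn one_ne_zero y
      (Ioo_subset_Icc_self hy)).hasDerivWithinAt).hasDerivAt (Icc_mem_nhds hy.1 hy.2)
  have hac := h.absolutelyContinuous
  rw [← hw] at hac
  have hli : IntervalIntegrable (fun y => robinGreen a x y * deriv w y) volume
      (-Real.pi) Real.pi :=
    hac.intervalIntegrable_deriv.continuousOn_mul (continuous_robinGreen a x).continuousOn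
  have e1 : ∫ y in Icc (-Real.pi) Real.pi, robinGreen a x y * f y =
      -∫ y in (-Real.pi)..Real.pi, robinGreen a x y * deriv w y := by
    rw [intervalIntegral.integral_of_le (by linarith), ← integral_Icc_eq_integral_Ioc,
      ← integral_neg]
    refine integral_congr_ae ?_
    filter_upwards [h.ae_deriv_eq] with y hy
    rw [← hw] at hy
    simp [hy]
  have hl : uIcc (-Real.pi) x ⊆ uIcc (-Real.pi) Real.pi := by
    rw [uIcc_of_le hx.1, uIcc_of_le (by linarith)]; exact Icc_subset_Icc_right hx.2
  have hr : uIcc x Real.pi ⊆ uIcc (-Real.pi) Real.pi := by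
    rw [uIcc_of_le hx.2, uIcc_of_le (by linarith)]; exact Icc_subset_Icc_left hx.1
  rw [e1, ← intervalIntegral.integral_add_adjacent_intervals (hli.mono_set hl) (hli.mono_set hr)]
  have i1 : ∫ y in (-Real.pi)..x, robinGreen a x y * deriv w y =
      ∫ y in (-Real.pi)..x, ((1 / (4 * a) - x / 2) + (1 / 2 - a * x) * y) * deriv w y := by
    refine intervalIntegral.integral_congr fun y hy => ?_
    rw [uIcc_of_le hx.1] at hy
    simp only [robinGreen_of_le hy.2]
  have i2 : ∫ y in x..Real.pi, robinGreen a x y * deriv w y =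
      ∫ y in x..Real.pi, ((1 / (4 * a) + x / 2) + (-1 / 2 - a * x) * y) * deriv w y := by
    refine intervalIntegral.integral_congr fun y hy => ?_
    rw [uIcc_of_le hx.2] at hy
    simp only [robinGreen_of_ge hy.1]
  rw [i1, i2,
    integral_affine_mul_deriv hx.1 (hac.mono hl) (huc.mono (Icc_subset_Icc_right hx.2))
      (fun y hy => huw y ⟨hy.1, hy.2.trans_le hx.2⟩),
    integral_affine_mul_deriv hx.2 (hac.mono hr) (huc.mono (Icc_subset_Icc_left hx.1))
      (fun y hy => huw y ⟨hx.1.trans_lt hy.1, hy.2⟩)]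
  have hL : w (-Real.pi) = α * u (-Real.pi) := by linarith [h.left_condition]
  have hR : w Real.pi = -(α * u Real.pi) := by linarith [h.right_condition]
  rw [hL, hR]
  -- This is `haα` divided by `4 * a`. It says that the kernel satisfies the Robin conditions in
  -- `y`, so the terms at `±π` cancel.
  have k : α * (1 / (4 * a) - Real.pi / 2) = 1 / 2 := by
    field_simp; linarith
  have k' : a * (1 / (4 * a)) = 1 / 4 := by field_simp
  linear_combination (-(1 + 2 * a * x) * u Real.pi - (1 - 2 * a * x) * u (-Real.pi)) * k
    + 2 * α * x * (u Real.pi - u (-Real.pi)) * k'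

end Representation

/-! ### The bathtub principle -/

section Bathtub

variable {X : Type*} [MeasurableSpace X] {μ : Measure X} {E J : Set X} {f : X → ℝ} {c : ℝ}

lemma measureReal_diff_eq_of_measureReal_eq (hE : NullMeasurableSet E μ) (hJ : MeasurableSet J)
    (hEJ : μ.real E = μ.real J) (hEf : μ E ≠ ⊤) (hJf : μ J ≠ ⊤) :
    μ.real (E \ J) = μ.real (J \ E) := by
  have h1 := measureReal_inter_add_sdiff₀ (μ := μ) (s := E) hJ.nullMeasurableSet hEf
  have h2 := measureReal_inter_add_sdiff₀ (μ := μ) (s := J) hE hJf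
  rw [inter_comm] at h2
  linarith

/-- `E \ J` and `J \ E` have equal measure, so the constant `c` cancels. When `J` is a superlevel
set at level `c`, both terms on the right are non-negative, which gives the inequality and its
equality case. -/
lemma setIntegral_sub_setIntegral_of_measureReal_eq (hE : NullMeasurableSet E μ)
    (hJ : MeasurableSet J) (hEJ : μ.real E = μ.real J) (hEf : μ E ≠ ⊤) (hJf : μ J ≠ ⊤)
    (hfE : IntegrableOn f E μ) (hfJ : IntegrableOn f J μ) (c : ℝ) :
    ∫ x in J, f x ∂μ - ∫ x in E, f x ∂μ =
      ∫ x in J \ E, (f x - c) ∂μ + ∫ x in E \ J, (c - f x) ∂μ := by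
  have h1 := integral_inter_add_sdiff₀ (μ := μ) (s := E) hJ.nullMeasurableSet hfE
  have h2 := integral_inter_add_sdiff₀ (μ := μ) (s := J) hE hfJ
  rw [inter_comm] at h2
  have h3 := measureReal_diff_eq_of_measureReal_eq hE hJ hEJ hEf hJf
  have c1 : IntegrableOn (fun _ : X => c) (J \ E) μ :=
    integrableOn_const (ne_top_of_le_ne_top hJf (measure_mono sdiff_subset))
  have c2 : IntegrableOn (fun _ : X => c) (E \ J) μ :=
    integrableOn_const (ne_top_of_le_ne_top hEf (measure_mono sdiff_subset))
  rw [integral_sub (hfJ.mono_set sdiff_subset) c1, integral_sub c2 (hfE.mono_set sdiff_subset),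
    setIntegral_const, setIntegral_const, h3]
  linarith

/-- The bathtub principle. -/
lemma setIntegral_le_of_superlevel (hE : NullMeasurableSet E μ) (hJ : MeasurableSet J)
    (hEJ : μ.real E = μ.real J) (hEf : μ E ≠ ⊤) (hJf : μ J ≠ ⊤)
    (hfE : IntegrableOn f E μ) (hfJ : IntegrableOn f J μ)
    (h1 : ∀ x ∈ J, c ≤ f x) (h2 : ∀ x ∉ J, f x ≤ c) :
    ∫ x in E, f x ∂μ ≤ ∫ x in J, f x ∂μ := by
  have h := setIntegral_sub_setIntegral_of_measureReal_eq hE hJ hEJ hEf hJf hfE hfJ c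
  have a1 : 0 ≤ ∫ x in J \ E, (f x - c) ∂μ := by
    refine integral_nonneg_of_ae ?_
    filter_upwards [ae_restrict_mem₀ (hJ.nullMeasurableSet.diff hE)] with x hx
    exact sub_nonneg.2 (h1 x hx.1)
  have a2 : 0 ≤ ∫ x in E \ J, (c - f x) ∂μ := by
    refine integral_nonneg_of_ae ?_
    filter_upwards [ae_restrict_mem₀ (hE.diff hJ.nullMeasurableSet)] with x hx
    exact sub_nonneg.2 (h2 x hx.2)
  linarith

/-- The equality case of the bathtub principle. -/
lemma ae_eq_of_setIntegral_eq_of_superlevel (hE : NullMeasurableSet E μ) (hJ : MeasurableSet J)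
    (hEJ : μ.real E = μ.real J) (hEf : μ E ≠ ⊤) (hJf : μ J ≠ ⊤)
    (hfE : IntegrableOn f E μ) (hfJ : IntegrableOn f J μ)
    (h1 : ∀ x ∈ J, c ≤ f x) (h2 : ∀ x ∉ J, f x < c)
    (heq : ∫ x in E, f x ∂μ = ∫ x in J, f x ∂μ) : E =ᵐ[μ] J := by
  have h := setIntegral_sub_setIntegral_of_measureReal_eq hE hJ hEJ hEf hJf hfE hfJ c
  have a1 : 0 ≤ ∫ x in J \ E, (f x - c) ∂μ := by
    refine integral_nonneg_of_ae ?_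
    filter_upwards [ae_restrict_mem₀ (hJ.nullMeasurableSet.diff hE)] with x hx
    exact sub_nonneg.2 (h1 x hx.1)
  have hpos : 0 ≤ᵐ[μ.restrict (E \ J)] fun x => c - f x := by
    filter_upwards [ae_restrict_mem₀ (hE.diff hJ.nullMeasurableSet)] with x hx
    exact sub_nonneg.2 (h2 x hx.2).le
  have a2 : ∫ x in E \ J, (c - f x) ∂μ = 0 :=
    le_antisymm (by linarith) (integral_nonneg_of_ae hpos)
  have hi : IntegrableOn (fun x => c - f x) (E \ J) μ :=
    (integrableOn_const (ne_top_of_le_ne_top hEf (measure_mono sdiff_subset))).sub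
      (hfE.mono_set sdiff_subset)
  rw [integral_eq_zero_iff_of_nonneg_ae hpos hi] at a2
  -- The strict inequality in `h2` makes `E \ J` null; equality of measures then does the same for
  -- `J \ E`.
  have hz : μ (E \ J) = 0 := by
    have : ∀ᵐ x ∂(μ.restrict (E \ J)), False := by
      filter_upwards [a2, ae_restrict_mem₀ (hE.diff hJ.nullMeasurableSet)] with x hx hx'
      have := h2 x hx'.2
      simp only [Pi.zero_apply] at hx
      linarith
    rwa [Filter.eventually_false_iff_eq_bot, ae_eq_bot, Measure.restrict_eq_zero] at this
  have hz' : μ (J \ E) = 0 := by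
    have h3 := measureReal_diff_eq_of_measureReal_eq hE hJ hEJ hEf hJf
    have hne : μ (J \ E) ≠ ⊤ := ne_top_of_le_ne_top hJf (measure_mono sdiff_subset)
    rw [measureReal_def, measureReal_def, hz, ENNReal.toReal_zero] at h3
    exact ((ENNReal.toReal_eq_zero_iff _).1 h3.symm).resolve_right hne
  exact Filter.EventuallyLE.antisymm (ae_le_set.2 hz) (ae_le_set.2 hz')

end Bathtub

/-! ### Superlevel intervals of the Green's function -/

/-- The superlevel interval of length `m` of `robinGreen a x`. -/
def greenInterval (a x m : ℝ) : Set ℝ :=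
  Icc (x - m * (1 / 2 + a * x)) (x + m * (1 / 2 - a * x))

lemma volume_real_greenInterval {a x m : ℝ} (hm : 0 ≤ m) :
    volume.real (greenInterval a x m) = m := by
  rw [greenInterval, Real.volume_real_Icc_of_le (by linarith)]; ring

lemma robinGreen_eq_sub (a x y : ℝ) :
    robinGreen a x y = 1 / (4 * a) - a * x ^ 2 - a * x * (y - x) - |x - y| / 2 := by
  rw [robinGreen]; ring

/-- The kernel has slope `1/2 - ax` to the left of its peak and `-(1/2 + ax)` to the right, so at
both ends of the interval it has fallen by `m (1/4 - (ax)²)`. -/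
lemma le_robinGreen_of_mem {a x m y : ℝ} (h : |a * x| < 1 / 2) (hy : y ∈ greenInterval a x m) :
    1 / (4 * a) - a * x ^ 2 - m * (1 / 4 - (a * x) ^ 2) ≤ robinGreen a x y := by
  obtain ⟨h1, h2⟩ := abs_lt.1 h
  obtain ⟨h3, h4⟩ := hy
  rw [robinGreen_eq_sub]
  rcases abs_cases (x - y) with ⟨e, _⟩ | ⟨e, _⟩ <;> rw [e]
  · nlinarith [mul_le_mul_of_nonneg_left h3 (by linarith : 0 ≤ 1 / 2 - a * x)]
  · nlinarith [mul_le_mul_of_nonneg_left h4 (by linarith : 0 ≤ 1 / 2 + a * x)]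

lemma robinGreen_lt_of_notMem {a x m y : ℝ} (hm : 0 ≤ m) (h : |a * x| < 1 / 2)
    (hy : y ∉ greenInterval a x m) :
    robinGreen a x y < 1 / (4 * a) - a * x ^ 2 - m * (1 / 4 - (a * x) ^ 2) := by
  obtain ⟨h1, h2⟩ := abs_lt.1 h
  rw [greenInterval, mem_Icc, not_and_or, not_le, not_le] at hy
  rw [robinGreen_eq_sub]
  rcases hy with hy | hy
  · have : 0 ≤ x - y := by nlinarith
    rw [abs_of_nonneg this]
    nlinarith [mul_lt_mul_of_pos_left hy (by linarith : 0 < 1 / 2 - a * x)]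
  · have : x - y ≤ 0 := by nlinarith
    rw [abs_of_nonpos this]
    nlinarith [mul_lt_mul_of_pos_left hy (by linarith : 0 < 1 / 2 + a * x)]

lemma setIntegral_robinGreen_greenInterval {a x m : ℝ} (hm : 0 ≤ m) (h : |a * x| < 1 / 2) :
    ∫ y in greenInterval a x m, robinGreen a x y =
      m / (4 * a) - m ^ 2 / 8 - m * (a * x ^ 2 - m * (a * x) ^ 2 / 2) := by
  obtain ⟨h1, h2⟩ := abs_lt.1 h
  have hl : x - m * (1 / 2 + a * x) ≤ x := by nlinarith
  have hr : x ≤ x + m * (1 / 2 - a * x) := by nlinarith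
  have hi : ∀ p q, IntervalIntegrable (robinGreen a x) volume p q := fun p q =>
    (continuous_robinGreen a x).intervalIntegrable p q
  have key : ∀ A B p q : ℝ, ∫ y in p..q, (A + B * y) = A * (q - p) + B * ((q ^ 2 - p ^ 2) / 2) := by
    intro A B p q
    have hc : IntervalIntegrable (fun y => B * y) volume p q :=
      (continuous_const.mul continuous_id).intervalIntegrable _ _
    rw [intervalIntegral.integral_add intervalIntegrable_const hc,
      intervalIntegral.integral_const_mul]
    simp [mul_comm]
  rw [greenInterval, integral_Icc_eq_integral_Ioc, ← intervalIntegral.integral_of_le (hl.trans hr),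
    ← intervalIntegral.integral_add_adjacent_intervals (hi _ x) (hi x _)]
  have i1 : ∫ y in (x - m * (1 / 2 + a * x))..x, robinGreen a x y =
      ∫ y in (x - m * (1 / 2 + a * x))..x, ((1 / (4 * a) - x / 2) + (1 / 2 - a * x) * y) := by
    refine intervalIntegral.integral_congr fun y hy => ?_
    rw [uIcc_of_le hl] at hy
    exact robinGreen_of_le hy.2
  have i2 : ∫ y in x..(x + m * (1 / 2 - a * x)), robinGreen a x y =
      ∫ y in x..(x + m * (1 / 2 - a * x)), ((1 / (4 * a) + x / 2) + (-1 / 2 - a * x) * y) := by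
    refine intervalIntegral.integral_congr fun y hy => ?_
    rw [uIcc_of_le hr] at hy
    exact robinGreen_of_ge hy.1
  rw [i1, i2, key, key]
  have e : m / (4 * a) = m * (1 / (4 * a)) := by ring
  rw [e]
  -- The identity is polynomial with `1 / (4 * a)` as a free variable.
  generalize 1 / (4 * a) = b
  ring

/-! ### The sharp inequality for sets -/

section SetInequality

variable {a x : ℝ} {E : Set ℝ}

lemma abs_mul_lt_half (ha : 0 < a) (ha' : 2 * a * Real.pi < 1)
    (hx : x ∈ Icc (-Real.pi) Real.pi) : |a * x| < 1 / 2 := by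
  rw [abs_lt]; constructor <;> nlinarith [hx.1, hx.2]

lemma measureReal_le_two_pi (hE : E ⊆ Icc (-Real.pi) Real.pi) :
    volume.real E ≤ 2 * Real.pi := by
  refine (measureReal_mono hE measure_Icc_lt_top.ne).trans ?_
  rw [Real.volume_real_Icc_of_le (by linarith [Real.pi_pos])]; linarith

/-- The bathtub principle is applied on all of `ℝ`: the competing interval may leave `[-π, π]`,
which does no harm to an upper bound. -/
lemma setIntegral_robinGreen_le_sub (ha : 0 < a) (ha' : 2 * a * Real.pi < 1)
    (hx : x ∈ Icc (-Real.pi) Real.pi) (hE : NullMeasurableSet E)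
    (hEK : E ⊆ Icc (-Real.pi) Real.pi) :
    ∫ y in E, robinGreen a x y ≤ volume.real E / (4 * a) - volume.real E ^ 2 / 8 -
      volume.real E * (a * x ^ 2 - volume.real E * (a * x) ^ 2 / 2) := by
  have h := abs_mul_lt_half ha ha' hx
  have hm : 0 ≤ volume.real E := measureReal_nonneg
  rw [← setIntegral_robinGreen_greenInterval hm h]
  exact setIntegral_le_of_superlevel hE measurableSet_Icc (volume_real_greenInterval hm).symm
    (ne_top_of_le_ne_top measure_Icc_lt_top.ne (measure_mono hEK)) measure_Icc_lt_top.ne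
    ((continuous_robinGreen a x).integrableOn_Icc.mono_set hEK)
    (continuous_robinGreen a x).integrableOn_Icc
    (fun y hy => le_robinGreen_of_mem h hy) (fun y hy => (robinGreen_lt_of_notMem hm h hy).le)

/-- Since `am ≤ 2aπ < 1`, the quadratic correction uses up at most half of `m a x²`. -/
lemma deficit_lower_bound {m : ℝ} (ha : 0 < a) (ha' : 2 * a * Real.pi < 1) (hm : 0 ≤ m)
    (hm' : m ≤ 2 * Real.pi) :
    m * (a * x ^ 2) / 2 ≤ m * (a * x ^ 2 - m * (a * x) ^ 2 / 2) := by
  have h1 : 0 ≤ 1 - a * m := by nlinarith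
  have h2 : 0 ≤ m * (a * x ^ 2) * (1 - a * m) := by positivity
  nlinarith

/-- Among sets `E` of given measure and points `x`, `∫ y in E, robinGreen a x y` is largest for the
centred interval and the centre. -/
lemma setIntegral_robinGreen_le (ha : 0 < a) (ha' : 2 * a * Real.pi < 1)
    (hx : x ∈ Icc (-Real.pi) Real.pi) (hE : NullMeasurableSet E)
    (hEK : E ⊆ Icc (-Real.pi) Real.pi) :
    ∫ y in E, robinGreen a x y ≤ volume.real E / (4 * a) - volume.real E ^ 2 / 8 := by
  have h := setIntegral_robinGreen_le_sub ha ha' hx hE hEK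
  have hm : 0 ≤ volume.real E := measureReal_nonneg
  have h2 := deficit_lower_bound (x := x) ha ha' hm (measureReal_le_two_pi hEK)
  have : 0 ≤ volume.real E * (a * x ^ 2) := by positivity
  linarith

lemma greenInterval_zero (a m : ℝ) : greenInterval a 0 m = Icc (-(m / 2)) (m / 2) := by
  rw [greenInterval]; congr 1 <;> ring

lemma setIntegral_robinGreen_zero_Ioo {m : ℝ} (hm : 0 ≤ m) :
    ∫ y in Ioo (-(m / 2)) (m / 2), robinGreen a 0 y = m / (4 * a) - m ^ 2 / 8 := by
  have h := setIntegral_robinGreen_greenInterval (a := a) (x := 0) hm (by norm_num)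
  rw [← integral_Icc_eq_integral_Ioo, ← greenInterval_zero a, h]
  ring

/-- A vanishing deficit forces `x = 0`, and then the equality case of the bathtub principle applies.
Null sets are treated apart, as for them equality holds at every `x`. -/
lemma ae_eq_Ioo_of_setIntegral_robinGreen_eq (ha : 0 < a) (ha' : 2 * a * Real.pi < 1)
    (hx : x ∈ Icc (-Real.pi) Real.pi) (hE : NullMeasurableSet E)
    (hEK : E ⊆ Icc (-Real.pi) Real.pi)
    (heq : ∫ y in E, robinGreen a x y = volume.real E / (4 * a) - volume.real E ^ 2 / 8) :
    E =ᵐ[volume] Ioo (-(volume.real E / 2)) (volume.real E / 2) := by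
  have hEf : volume E ≠ ⊤ := ne_top_of_le_ne_top measure_Icc_lt_top.ne (measure_mono hEK)
  have hm : 0 ≤ volume.real E := measureReal_nonneg
  rcases hm.eq_or_lt with h0 | h0
  · rw [← h0]
    simp only [zero_div, neg_zero, Ioo_self]
    exact ae_eq_empty.2 (((ENNReal.toReal_eq_zero_iff _).1 h0.symm).resolve_right hEf)
  have h := setIntegral_robinGreen_le_sub ha ha' hx hE hEK
  have h2 := deficit_lower_bound (x := x) ha ha' hm (measureReal_le_two_pi hEK)
  have hx0 : x = 0 := by
    by_contra hne
    have : 0 < volume.real E * (a * x ^ 2) := by positivity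
    linarith
  subst hx0
  have habs : |a * (0 : ℝ)| < 1 / 2 := by norm_num
  have hJ : E =ᵐ[volume] greenInterval a 0 (volume.real E) := by
    refine ae_eq_of_setIntegral_eq_of_superlevel hE measurableSet_Icc
      (volume_real_greenInterval hm).symm hEf measure_Icc_lt_top.ne
      ((continuous_robinGreen a 0).integrableOn_Icc.mono_set hEK)
      (continuous_robinGreen a 0).integrableOn_Icc
      (fun y hy => le_robinGreen_of_mem habs hy)
      (fun y hy => robinGreen_lt_of_notMem hm habs hy) ?_
    rw [heq, setIntegral_robinGreen_greenInterval hm habs]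
    ring
  refine hJ.trans ?_
  rw [greenInterval_zero]
  exact Ioo_ae_eq_Icc.symm

end SetInequality

/-! ### Layer cake decomposition -/

/-- The part of the superlevel set `{f > s}` in `[-π, π]`. -/
def superlevel (f : ℝ → ℝ) (s : ℝ) : Set ℝ := {y | y ∈ Icc (-Real.pi) Real.pi ∧ s < f y}

section LayerCake

variable {a x : ℝ} {f : ℝ → ℝ}

lemma superlevel_subset (f : ℝ → ℝ) (s : ℝ) : superlevel f s ⊆ Icc (-Real.pi) Real.pi :=
  fun _ hy => hy.1

lemma superlevel_anti (f : ℝ → ℝ) : Antitone (superlevel f) :=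
  fun _ _ hst _ hy => ⟨hy.1, hst.trans_lt hy.2⟩

lemma volume_superlevel_ne_top (f : ℝ → ℝ) (s : ℝ) : volume (superlevel f s) ≠ ⊤ :=
  ne_top_of_le_ne_top measure_Icc_lt_top.ne (measure_mono (superlevel_subset f s))

lemma volume_real_superlevel_anti (f : ℝ → ℝ) : Antitone fun s => volume.real (superlevel f s) :=
  fun _ _ hst => measureReal_mono (superlevel_anti f hst) (volume_superlevel_ne_top _ _)

lemma nullMeasurableSet_superlevel
    (hf : AEMeasurable f (volume.restrict (Icc (-Real.pi) Real.pi))) (s : ℝ) :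
    NullMeasurableSet (superlevel f s) := by
  have h : MeasurableSet (superlevel (hf.mk f) s) :=
    measurableSet_Icc.inter (measurableSet_lt measurable_const hf.measurable_mk)
  refine h.nullMeasurableSet.congr ?_
  filter_upwards [(ae_restrict_iff' measurableSet_Icc).1 hf.ae_eq_mk] with y hy
  refine propext ⟨fun h => ⟨h.1, ?_⟩, fun h => ⟨h.1, ?_⟩⟩
  · rw [hy h.1]; exact h.2
  · rw [← hy h.1]; exact h.2

/-- This is the layer cake formula for the measure with density `robinGreen a x` on `[-π, π]`. -/
lemma ofReal_integral_robinGreen_mul (ha : 0 < a) (ha' : 2 * a * Real.pi < 1)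
    (hx : x ∈ Icc (-Real.pi) Real.pi) (hf : IntegrableOn f (Icc (-Real.pi) Real.pi))
    (hf0 : ∀ᵐ y ∂(volume.restrict (Icc (-Real.pi) Real.pi)), 0 ≤ f y) :
    ENNReal.ofReal (∫ y in Icc (-Real.pi) Real.pi, robinGreen a x y * f y) =
      ∫⁻ s in Ioi 0, ENNReal.ofReal (∫ y in superlevel f s, robinGreen a x y) := by
  set K := Icc (-Real.pi) Real.pi
  have hG : ∀ᵐ y ∂(volume.restrict K), 0 ≤ robinGreen a x y := by
    filter_upwards [ae_restrict_mem measurableSet_Icc] with y hy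
    exact robinGreen_nonneg ha ha' hx hy
  have hGm : Measurable fun y => ENNReal.ofReal (robinGreen a x y) :=
    (continuous_robinGreen a x).measurable.ennreal_ofReal
  set ν := (volume.restrict K).withDensity fun y => ENNReal.ofReal (robinGreen a x y) with hν
  have hac : ν ≪ volume.restrict K := withDensity_absolutelyContinuous _ _
  have hfm : AEMeasurable f (volume.restrict K) := hf.aemeasurable
  have hi : Integrable (fun y => robinGreen a x y * f y) (volume.restrict K) :=
    hf.continuousOn_mul (continuous_robinGreen a x).continuousOn isCompact_Icc
  rw [ofReal_integral_eq_lintegral_ofReal hi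
    (by filter_upwards [hG, hf0] with y h1 h2 using mul_nonneg h1 h2)]
  have e1 : ∫⁻ y in K, ENNReal.ofReal (robinGreen a x y * f y) =
      ∫⁻ y, ENNReal.ofReal (f y) ∂ν := by
    rw [hν, lintegral_withDensity_eq_lintegral_mul₀ hGm.aemeasurable hfm.ennreal_ofReal]
    refine lintegral_congr_ae ?_
    filter_upwards [hG] with y h1
    simp only [Pi.mul_apply]
    rw [ENNReal.ofReal_mul h1]
  rw [e1, lintegral_eq_lintegral_meas_lt ν (hac.ae_le hf0) (hfm.mono_ac hac)]
  refine lintegral_congr fun s => ?_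
  have hs : NullMeasurableSet (superlevel f s) := nullMeasurableSet_superlevel hfm s
  have e2 : ν {y | s < f y} = ν (superlevel f s) := by
    refine measure_congr ?_
    filter_upwards [hac.ae_le (ae_restrict_mem measurableSet_Icc)] with y hy
    exact propext ⟨fun h => ⟨hy, h⟩, fun h => h.2⟩
  rw [e2, hν, withDensity_apply₀ _ (hs.mono_ac Measure.restrict_le_self.absolutelyContinuous),
    Measure.restrict_restrict_of_subset (superlevel_subset f s),
    ofReal_integral_eq_lintegral_ofReal]
  · exact (continuous_robinGreen a x).integrableOn_Icc.mono_set (superlevel_subset f s)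
  · filter_upwards [ae_restrict_mem₀ hs] with y hy
    exact robinGreen_nonneg ha ha' hx (superlevel_subset f s hy)

/-- The value at the centre of the solution with source `f^#`, in terms of the distribution
function of `f`. -/
noncomputable def centralValue (a : ℝ) (f : ℝ → ℝ) : ENNReal :=
  ∫⁻ s in Ioi (0 : ℝ), ENNReal.ofReal
    (volume.real (superlevel f s) / (4 * a) - volume.real (superlevel f s) ^ 2 / 8)

lemma integral_robinGreen_mul_le_centralValue (ha : 0 < a) (ha' : 2 * a * Real.pi < 1)
    (hx : x ∈ Icc (-Real.pi) Real.pi) (hf : IntegrableOn f (Icc (-Real.pi) Real.pi))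
    (hf0 : ∀ᵐ y ∂(volume.restrict (Icc (-Real.pi) Real.pi)), 0 ≤ f y) :
    ENNReal.ofReal (∫ y in Icc (-Real.pi) Real.pi, robinGreen a x y * f y) ≤
      centralValue a f := by
  rw [ofReal_integral_robinGreen_mul ha ha' hx hf hf0]
  exact lintegral_mono fun s => ENNReal.ofReal_le_ofReal
    (setIntegral_robinGreen_le ha ha' hx (nullMeasurableSet_superlevel hf.aemeasurable s)
      (superlevel_subset f s))

/-- The bound holds at every level and the integrals over the levels are equal and finite, so
equality holds at almost every level. -/
lemma ae_superlevel_eq_Ioo (ha : 0 < a) (ha' : 2 * a * Real.pi < 1)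
    (hx : x ∈ Icc (-Real.pi) Real.pi) (hf : IntegrableOn f (Icc (-Real.pi) Real.pi))
    (hf0 : ∀ᵐ y ∂(volume.restrict (Icc (-Real.pi) Real.pi)), 0 ≤ f y)
    (heq : ENNReal.ofReal (∫ y in Icc (-Real.pi) Real.pi, robinGreen a x y * f y) =
      centralValue a f) :
    ∀ᵐ s : ℝ, 0 < s → superlevel f s =ᵐ[volume]
      Ioo (-(volume.real (superlevel f s) / 2)) (volume.real (superlevel f s) / 2) := by
  have hfin : ENNReal.ofReal (∫ y in Icc (-Real.pi) Real.pi, robinGreen a x y * f y) ≠ ⊤ :=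
    ENNReal.ofReal_ne_top
  rw [ofReal_integral_robinGreen_mul ha ha' hx hf hf0] at heq hfin
  have hle : ∀ s, ∫ y in superlevel f s, robinGreen a x y ≤
      volume.real (superlevel f s) / (4 * a) - volume.real (superlevel f s) ^ 2 / 8 := fun s =>
    setIntegral_robinGreen_le ha ha' hx (nullMeasurableSet_superlevel hf.aemeasurable s)
      (superlevel_subset f s)
  have hm := (volume_real_superlevel_anti f).measurable
  have := ae_eq_of_ae_le_of_lintegral_le
    (Filter.Eventually.of_forall fun s => ENNReal.ofReal_le_ofReal (hle s)) hfin
    ((hm.div_const (4 * a)).sub ((hm.pow_const 2).div_const 8)).ennreal_ofReal.aemeasurable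
    (heq.symm.le)
  filter_upwards [(ae_restrict_iff' measurableSet_Ioi).1 this] with s hs hs0
  have hs := hs hs0
  have hnn : 0 ≤ ∫ y in superlevel f s, robinGreen a x y := by
    refine integral_nonneg_of_ae ?_
    filter_upwards [ae_restrict_mem₀ (nullMeasurableSet_superlevel hf.aemeasurable s)] with y hy
    exact robinGreen_nonneg ha ha' hx (superlevel_subset f s hy)
  rw [ENNReal.ofReal_eq_ofReal_iff hnn (hnn.trans (hle s))] at hs
  exact ae_eq_Ioo_of_setIntegral_robinGreen_eq ha ha' hx
    (nullMeasurableSet_superlevel hf.aemeasurable s) (superlevel_subset f s) hs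

end LayerCake

/-! ### The symmetric decreasing rearrangement -/

lemma EReal.sInf_image_coe {S : Set ℝ} (hne : S.Nonempty) (hbd : BddBelow S) :
    sInf ((fun s : ℝ => (s : EReal)) '' S) = ((sInf S : ℝ) : EReal) := by
  refine IsGLB.sInf_eq ⟨?_, fun b hb => ?_⟩
  · rintro _ ⟨s, hs, rfl⟩
    exact EReal.coe_le_coe_iff.2 (csInf_le hbd hs)
  · obtain ⟨s₀, hs₀⟩ := hne
    induction b using EReal.rec with
    | bot => exact bot_le
    | top => exact absurd (hb (mem_image_of_mem _ hs₀)) (by simp)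
    | coe b =>
      exact EReal.coe_le_coe_iff.2 (le_csInf ⟨s₀, hs₀⟩ fun s hs =>
        EReal.coe_le_coe_iff.1 (hb (mem_image_of_mem _ hs)))

section Rearrangement

variable {f : ℝ → ℝ}

/-- Right continuity of the distribution function, from continuity of measure along increasing
unions. -/
lemma exists_gt_of_lt_volume_superlevel {s : ℝ} {t : ENNReal}
    (h : t < volume (superlevel f s)) : ∃ s' > s, t < volume (superlevel f s') := by
  have hU : superlevel f s = ⋃ n : ℕ, superlevel f (s + 1 / (n + 1)) := by
    ext y
    simp only [mem_iUnion]
    refine ⟨fun hy => ?_, fun ⟨n, hn⟩ => superlevel_anti f ?_ hn⟩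
    · obtain ⟨n, hn⟩ := exists_nat_one_div_lt (sub_pos.2 hy.2)
      exact ⟨n, hy.1, by linarith⟩
    · have : (0 : ℝ) < 1 / (n + 1) := by positivity
      linarith
  have hmono : Monotone fun n : ℕ => superlevel f (s + 1 / (n + 1)) := fun m n hmn =>
    superlevel_anti f (by gcongr)
  rw [hU, hmono.measure_iUnion, lt_iSup_iff] at h
  obtain ⟨n, hn⟩ := h
  have : (0 : ℝ) < 1 / (n + 1) := by positivity
  exact ⟨_, by linarith, hn⟩

lemma exists_volume_superlevel_lt (hf : AEMeasurable f (volume.restrict (Icc (-Real.pi) Real.pi)))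
    {t : ENNReal} (ht : 0 < t) : ∃ s, volume (superlevel f s) < t := by
  have h := tendsto_measure_iInter_atTop (μ := volume) (s := fun n : ℕ => superlevel f n)
    (fun n => nullMeasurableSet_superlevel hf n)
    (fun m n hmn => superlevel_anti f (by exact_mod_cast hmn)) ⟨0, volume_superlevel_ne_top _ _⟩
  have hE : ⋂ n : ℕ, superlevel f n = ∅ := by
    ext y
    simp only [mem_iInter, mem_empty_iff_false, iff_false, not_forall]
    obtain ⟨n, hn⟩ := exists_nat_gt (f y)
    exact ⟨n, fun hy => lt_asymm hn hy.2⟩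
  rw [hE, measure_empty] at h
  obtain ⟨n, hn⟩ := (h.eventually_lt_const ht).exists
  exact ⟨n, hn⟩

lemma volume_superlevel_of_neg
    (hf0 : ∀ᵐ y ∂(volume.restrict (Icc (-Real.pi) Real.pi)), 0 ≤ f y) {s : ℝ} (hs : s < 0) :
    volume (superlevel f s) = ENNReal.ofReal (2 * Real.pi) := by
  have : superlevel f s =ᵐ[volume] Icc (-Real.pi) Real.pi := by
    filter_upwards [(ae_restrict_iff' measurableSet_Icc).1 hf0] with y hy
    exact propext ⟨fun h => h.1, fun h => ⟨h, hs.trans_le (hy h)⟩⟩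
  rw [measure_congr this, Real.volume_Icc]
  congr 1; ring

/-- Away from the centre and the end-points, `f^#` is a non-negative real number characterised by
the distribution function of `f`. -/
lemma exists_symmDecreasingRearrangement_eq
    (hf : AEMeasurable f (volume.restrict (Icc (-Real.pi) Real.pi)))
    (hf0 : ∀ᵐ y ∂(volume.restrict (Icc (-Real.pi) Real.pi)), 0 ≤ f y) {x : ℝ} (hx0 : x ≠ 0)
    (hx : |x| < Real.pi) :
    ∃ r : ℝ, 0 ≤ r ∧ symmDecreasingRearrangement (Icc (-Real.pi) Real.pi) f x = r ∧
      ∀ s, s < r ↔ ENNReal.ofReal (2 * |x|) < volume (superlevel f s) := by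
  have hxp : 0 < |x| := abs_pos.2 hx0
  set S : Set ℝ := {s | volume (superlevel f s) ≤ ENNReal.ofReal (2 * |x|)} with hS
  have hne : S.Nonempty := by
    obtain ⟨s, hs⟩ := exists_volume_superlevel_lt hf
      (ENNReal.ofReal_pos.2 (by linarith : 0 < 2 * |x|))
    exact ⟨s, hs.le⟩
  have hlb : ∀ s ∈ S, 0 ≤ s := by
    intro s hs
    by_contra! hneg
    rw [hS, mem_ofPred_eq, volume_superlevel_of_neg hf0 hneg,
      ENNReal.ofReal_le_ofReal_iff (by linarith)] at hs
    linarith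
  refine ⟨sInf S, le_csInf hne hlb, ?_, fun s => ⟨fun h => ?_, fun h => ?_⟩⟩
  · rw [← EReal.sInf_image_coe hne ⟨0, hlb⟩, symmDecreasingRearrangement, decreasingRearrangement,
      if_neg (by linarith), if_neg]
    · rfl
    · rw [Real.volume_Icc, ENNReal.ofReal_eq_ofReal_iff (by linarith) (by linarith)]
      linarith
  · by_contra! hle
    exact absurd (csInf_le ⟨0, hlb⟩ (show s ∈ S from hle)) (not_le.2 h)
  -- Right continuity supplies a level above `s` that still bounds `S` from below, so the inequality
  -- `s < sInf S` is strict.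
  · obtain ⟨s', hs', h'⟩ := exists_gt_of_lt_volume_superlevel h
    refine hs'.trans_le (le_csInf hne fun q hq => ?_)
    by_contra! hlt
    exact absurd (h'.trans_le (measure_mono (superlevel_anti f hlt.le))) (not_lt.2 hq)

lemma ae_restrict_ne_zero_and_abs_lt_pi :
    ∀ᵐ x ∂(volume.restrict (Icc (-Real.pi) Real.pi)), x ≠ 0 ∧ |x| < Real.pi := by
  rw [← restrict_Ioo_eq_restrict_Icc]
  filter_upwards [ae_restrict_mem measurableSet_Ioo,
    ae_restrict_of_ae (Measure.ae_ne volume (0 : ℝ))] with x hx hx0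
  exact ⟨hx0, abs_lt.2 hx⟩

lemma ae_symmDecreasingRearrangement_toReal
    (hf : AEMeasurable f (volume.restrict (Icc (-Real.pi) Real.pi)))
    (hf0 : ∀ᵐ y ∂(volume.restrict (Icc (-Real.pi) Real.pi)), 0 ≤ f y) :
    ∀ᵐ x ∂(volume.restrict (Icc (-Real.pi) Real.pi)),
      0 ≤ (symmDecreasingRearrangement (Icc (-Real.pi) Real.pi) f x).toReal ∧
      ((symmDecreasingRearrangement (Icc (-Real.pi) Real.pi) f x).toReal : EReal) =
        symmDecreasingRearrangement (Icc (-Real.pi) Real.pi) f x := by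
  filter_upwards [ae_restrict_ne_zero_and_abs_lt_pi] with x hx
  obtain ⟨r, hr, e, -⟩ := exists_symmDecreasingRearrangement_eq hf hf0 hx.1 hx.2
  rw [e, EReal.toReal_coe]
  exact ⟨hr, rfl⟩

lemma superlevel_symmDecreasingRearrangement
    (hf : AEMeasurable f (volume.restrict (Icc (-Real.pi) Real.pi)))
    (hf0 : ∀ᵐ y ∂(volume.restrict (Icc (-Real.pi) Real.pi)), 0 ≤ f y) (s : ℝ) :
    superlevel (fun x => (symmDecreasingRearrangement (Icc (-Real.pi) Real.pi) f x).toReal) s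
      =ᵐ[volume] Ioo (-(volume.real (superlevel f s) / 2)) (volume.real (superlevel f s) / 2) := by
  filter_upwards [(ae_restrict_iff' measurableSet_Icc).1 ae_restrict_ne_zero_and_abs_lt_pi]
    with x hx
  have hmax := measureReal_le_two_pi (superlevel_subset f s)
  have hIoo : x ∈ Ioo (-(volume.real (superlevel f s) / 2)) (volume.real (superlevel f s) / 2) ↔
      2 * |x| < volume.real (superlevel f s) := by
    rw [mem_Ioo, ← abs_lt]; constructor <;> intro h <;> linarith
  have key : ∀ hxK : x ∈ Icc (-Real.pi) Real.pi,
      (s < (symmDecreasingRearrangement (Icc (-Real.pi) Real.pi) f x).toReal ↔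
        2 * |x| < volume.real (superlevel f s)) := by
    intro hxK
    obtain ⟨r, -, e, h⟩ := exists_symmDecreasingRearrangement_eq hf hf0 (hx hxK).1 (hx hxK).2
    rw [e, EReal.toReal_coe, h, measureReal_def,
      ENNReal.ofReal_lt_iff_lt_toReal (by positivity) (volume_superlevel_ne_top f s)]
  refine propext ⟨fun h => hIoo.2 ((key h.1).1 h.2), fun h => ?_⟩
  have h' := hIoo.1 h
  have hxK : x ∈ Icc (-Real.pi) Real.pi := abs_le.1 (by linarith)
  exact ⟨hxK, (key hxK).2 h'⟩

lemma volume_real_superlevel_symmDecreasingRearrangement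
    (hf : AEMeasurable f (volume.restrict (Icc (-Real.pi) Real.pi)))
    (hf0 : ∀ᵐ y ∂(volume.restrict (Icc (-Real.pi) Real.pi)), 0 ≤ f y) (s : ℝ) :
    volume.real (superlevel
      (fun x => (symmDecreasingRearrangement (Icc (-Real.pi) Real.pi) f x).toReal) s) =
      volume.real (superlevel f s) := by
  have hm : 0 ≤ volume.real (superlevel f s) := measureReal_nonneg
  rw [measureReal_congr (superlevel_symmDecreasingRearrangement hf hf0 s),
    Real.volume_real_Ioo_of_le (by linarith)]
  ring

lemma centralValue_symmDecreasingRearrangement (a : ℝ)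
    (hf : AEMeasurable f (volume.restrict (Icc (-Real.pi) Real.pi)))
    (hf0 : ∀ᵐ y ∂(volume.restrict (Icc (-Real.pi) Real.pi)), 0 ≤ f y) :
    centralValue a (fun x => (symmDecreasingRearrangement (Icc (-Real.pi) Real.pi) f x).toReal) =
      centralValue a f := by
  simp only [centralValue, volume_real_superlevel_symmDecreasingRearrangement hf hf0]

lemma ofReal_integral_robinGreen_zero_mul_symmDecreasingRearrangement {a : ℝ} (ha : 0 < a)
    (ha' : 2 * a * Real.pi < 1)
    (hf : AEMeasurable f (volume.restrict (Icc (-Real.pi) Real.pi)))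
    (hf0 : ∀ᵐ y ∂(volume.restrict (Icc (-Real.pi) Real.pi)), 0 ≤ f y)
    (hg : IntegrableOn (fun x =>
      (symmDecreasingRearrangement (Icc (-Real.pi) Real.pi) f x).toReal)
      (Icc (-Real.pi) Real.pi)) :
    ENNReal.ofReal (∫ y in Icc (-Real.pi) Real.pi, robinGreen a 0 y *
      (symmDecreasingRearrangement (Icc (-Real.pi) Real.pi) f y).toReal) = centralValue a f := by
  rw [ofReal_integral_robinGreen_mul ha ha' ⟨by linarith [Real.pi_pos], Real.pi_pos.le⟩ hg
    ((ae_symmDecreasingRearrangement_toReal hf hf0).mono fun x hx => hx.1), centralValue]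
  refine lintegral_congr fun s => ?_
  rw [setIntegral_congr_set (superlevel_symmDecreasingRearrangement hf hf0 s),
    setIntegral_robinGreen_zero_Ioo measureReal_nonneg]

/-- Functions that are non-negative on `[-π, π]` and have the same superlevel sets for almost every
positive level agree almost everywhere on `[-π, π]`. -/
lemma ae_eq_of_ae_superlevel_eq {g : ℝ → ℝ}
    (hf0 : ∀ᵐ y ∂(volume.restrict (Icc (-Real.pi) Real.pi)), 0 ≤ f y)
    (hg0 : ∀ᵐ y ∂(volume.restrict (Icc (-Real.pi) Real.pi)), 0 ≤ g y)
    (h : ∀ᵐ s : ℝ, 0 < s → superlevel f s =ᵐ[volume] superlevel g s) :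
    ∀ᵐ y ∂(volume.restrict (Icc (-Real.pi) Real.pi)), f y = g y := by
  -- Countably many levels allow one common null set, and density puts one of them between any two
  -- distinct values; it is positive because the smaller value is non-negative.
  obtain ⟨D, hDs, hDc, hD⟩ := (Measure.dense_of_ae h).exists_countable_dense_subset
  have hall : ∀ᵐ y : ℝ, ∀ s ∈ D, 0 < s → (y ∈ superlevel f s ↔ y ∈ superlevel g s) := by
    rw [ae_ball_iff hDc]
    intro s hs
    by_cases hs0 : 0 < s
    · filter_upwards [hDs hs hs0] with y hy _
      exact iff_of_eq hy
    · exact Filter.Eventually.of_forall fun y h => absurd h hs0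
  filter_upwards [hf0, hg0, ae_restrict_of_ae hall, ae_restrict_mem measurableSet_Icc]
    with y hfy hgy hy hyK
  by_contra hne
  rcases lt_or_gt_of_ne hne with hlt | hlt
  · obtain ⟨s, hs, h1, h2⟩ := hD.exists_between hlt
    exact lt_asymm h1 ((hy s hs (hfy.trans_lt h1)).2 ⟨hyK, h2⟩).2
  · obtain ⟨s, hs, h1, h2⟩ := hD.exists_between hlt
    exact lt_asymm h1 ((hy s hs (hgy.trans_lt h1)).1 ⟨hyK, h2⟩).2

end Rearrangement

/-! ### The supremum norm of continuous functions -/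

lemma supNorm_le_ofReal {u : ℝ → ℝ} {M : ℝ}
    (h : ∀ x ∈ Icc (-Real.pi) Real.pi, |u x| ≤ M) : supNorm u ≤ ENNReal.ofReal M := by
  rw [supNorm, eLpNorm_exponent_top]
  refine eLpNormEssSup_le_of_ae_bound ?_
  filter_upwards [ae_restrict_mem measurableSet_Icc] with x hx using h x hx

lemma ofReal_le_supNorm {u : ℝ → ℝ} (hu : ContinuousOn u (Icc (-Real.pi) Real.pi)) {x : ℝ}
    (hx : x ∈ Icc (-Real.pi) Real.pi) : ENNReal.ofReal (u x) ≤ supNorm u := by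
  have hpi := Real.pi_pos
  by_contra! hlt
  have hcont : ContinuousWithinAt (fun y => ENNReal.ofReal (u y)) (Icc (-Real.pi) Real.pi) x :=
    ENNReal.continuous_ofReal.continuousAt.comp_continuousWithinAt (hu x hx)
  obtain ⟨U, hU, hxU, hUs⟩ := mem_nhdsWithin.1 (hcont.eventually_const_lt hlt)
  -- Passing to the open interval covers the end-points: a neighbourhood of `x` meets it in a
  -- non-empty open set, which has positive measure.
  have hcl : x ∈ closure (Ioo (-Real.pi) Real.pi) := by
    rwa [closure_Ioo (by linarith)]
  have hne : (U ∩ Ioo (-Real.pi) Real.pi).Nonempty := mem_closure_iff.1 hcl U hU hxU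
  have hpos : 0 < volume (U ∩ Ioo (-Real.pi) Real.pi) :=
    (hU.inter isOpen_Ioo).measure_pos volume hne
  have hae : ∀ᵐ y ∂(volume.restrict (Icc (-Real.pi) Real.pi)), ‖u y‖ₑ ≤ supNorm u := by
    rw [supNorm, eLpNorm_exponent_top]
    exact enorm_ae_le_eLpNormEssSup u _
  refine hpos.ne' (measure_mono_null ?_ ((ae_restrict_iff' measurableSet_Icc).1 hae))
  intro y hy hle
  have hyK := Ioo_subset_Icc_self hy.2
  refine absurd (hle hyK) (not_le.2 ((hUs ⟨hy.1, hyK⟩).trans_le ?_))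
  rw [Real.enorm_eq_ofReal_abs]
  exact ENNReal.ofReal_le_ofReal (le_abs_self _)

lemma exists_supNorm_eq_ofReal {u : ℝ → ℝ} (hu : ContinuousOn u (Icc (-Real.pi) Real.pi))
    (hu0 : ∀ x ∈ Icc (-Real.pi) Real.pi, 0 ≤ u x) :
    ∃ x ∈ Icc (-Real.pi) Real.pi, supNorm u = ENNReal.ofReal (u x) := by
  obtain ⟨x, hx, hmax⟩ := isCompact_Icc.exists_isMaxOn
    (nonempty_Icc.2 (by linarith [Real.pi_pos])) hu
  refine ⟨x, hx, le_antisymm (supNorm_le_ofReal fun y hy => ?_) (ofReal_le_supNorm hu hx)⟩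
  rw [abs_of_nonneg (hu0 y hy)]
  exact hmax hy

lemma IsRobinSolution.nonneg {α a : ℝ} {f u : ℝ → ℝ} (h : IsRobinSolution α f u) (ha : 0 < a)
    (ha' : 2 * a * Real.pi < 1) (haα : α * (1 - 2 * a * Real.pi) = 2 * a)
    (hf0 : ∀ᵐ y ∂(volume.restrict (Icc (-Real.pi) Real.pi)), 0 ≤ f y) :
    ∀ x ∈ Icc (-Real.pi) Real.pi, 0 ≤ u x := by
  intro x hx
  rw [h.eq_integral_robinGreen ha haα hx]
  refine integral_nonneg_of_ae ?_
  filter_upwards [hf0, ae_restrict_mem measurableSet_Icc] with y hy hyK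
  exact mul_nonneg (robinGreen_nonneg ha ha' hx hyK) hy

/-! ### The main theorem -/

/-- Here `u = u_f` and `v = u_{f^#}`. The source `f^#` is made real-valued by `EReal.toReal`, which
changes it at most on the null set where `f^#` is infinite. -/
theorem theorem4p3 (α : ℝ) (hα : 0 < α) (f : ℝ → ℝ)
    (hf : IntegrableOn f (Icc (-Real.pi) Real.pi) volume)
    (hf0 : ∀ᵐ x ∂(volume.restrict (Icc (-Real.pi) Real.pi)), 0 ≤ f x)
    (u v : ℝ → ℝ) (hu : IsRobinSolution α f u)
    (hv : IsRobinSolution α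
      (fun x => (symmDecreasingRearrangement (Icc (-Real.pi) Real.pi) f x).toReal) v) :
    supNorm u ≤ supNorm v ∧
    supNorm v = ENNReal.ofReal (v 0) ∧
    (supNorm u = supNorm v ↔
      ∀ᵐ x ∂(volume.restrict (Icc (-Real.pi) Real.pi)),
        (f x : EReal) = symmDecreasingRearrangement (Icc (-Real.pi) Real.pi) f x) := by
  have hpi := Real.pi_pos
  obtain ⟨a, ha, ha', haα⟩ : ∃ a : ℝ, 0 < a ∧ 2 * a * Real.pi < 1 ∧
      α * (1 - 2 * a * Real.pi) = 2 * a := by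
    have h1 : 0 < 1 + α * Real.pi := by positivity
    refine ⟨α / (2 * (1 + α * Real.pi)), by positivity, ?_, ?_⟩
    · have : 2 * (α / (2 * (1 + α * Real.pi))) * Real.pi = α * Real.pi / (1 + α * Real.pi) := by
        field_simp
      rw [this, div_lt_one h1]
      linarith
    · field_simp
      ring
  have hfm := hf.aemeasurable
  have hg0 := (ae_symmDecreasingRearrangement_toReal hfm hf0).mono fun x hx => hx.1
  have h0 : (0 : ℝ) ∈ Icc (-Real.pi) Real.pi := ⟨by linarith, hpi.le⟩
  have hv0 : ENNReal.ofReal (v 0) = centralValue a f := by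
    rw [hv.eq_integral_robinGreen ha haα h0]
    exact ofReal_integral_robinGreen_zero_mul_symmDecreasingRearrangement ha ha' hfm hf0
      hv.integrableOn
  obtain ⟨x, hx, hux⟩ := exists_supNorm_eq_ofReal hu.contDiffOn.continuousOn
    (hu.nonneg ha ha' haα hf0)
  obtain ⟨z, hz, hvz⟩ := exists_supNorm_eq_ofReal hv.contDiffOn.continuousOn
    (hv.nonneg ha ha' haα hg0)
  rw [hu.eq_integral_robinGreen ha haα hx] at hux
  -- The pointwise bound is applied to `f^#` itself, which has the same distribution function as
  -- `f`.
  have hvs : supNorm v = ENNReal.ofReal (v 0) := by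
    refine le_antisymm ?_ (ofReal_le_supNorm hv.contDiffOn.continuousOn h0)
    rw [hvz, hv.eq_integral_robinGreen ha haα hz, hv0,
      ← centralValue_symmDecreasingRearrangement a hfm hf0]
    exact integral_robinGreen_mul_le_centralValue ha ha' hz hv.integrableOn hg0
  refine ⟨?_, hvs, fun heq => ?_, fun heq => ?_⟩
  · rw [hux, hvs, hv0]
    exact integral_robinGreen_mul_le_centralValue ha ha' hx hf hf0
  -- The norm of `u` is attained at `x`, so equal norms mean equality in the pointwise bound at `x`.
  · rw [hux, hvs, hv0] at heq
    have hfg := ae_eq_of_ae_superlevel_eq hf0 hg0 <| by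
      filter_upwards [ae_superlevel_eq_Ioo ha ha' hx hf hf0 heq] with s hs hs0
      exact (hs hs0).trans (superlevel_symmDecreasingRearrangement hfm hf0 s).symm
    filter_upwards [hfg, ae_symmDecreasingRearrangement_toReal hfm hf0] with y hy hy'
    rw [hy, hy'.2]
  · have huv : ∀ y ∈ Icc (-Real.pi) Real.pi, u y = v y := by
      intro y hy
      rw [hu.eq_integral_robinGreen ha haα hy, hv.eq_integral_robinGreen ha haα hy]
      refine integral_congr_ae ?_
      filter_upwards [heq] with t ht
      simp only [← ht, EReal.toReal_coe]
    refine eLpNorm_congr_ae ?_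
    filter_upwards [ae_restrict_mem measurableSet_Icc] with y hy using huv y hy
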